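/- Let $N\ge 2$ and $1\le k\le N-1$ be integers, let $X_1,\dots,X_N$ be independent random variables, each uniformly distributed on $[0,1]$, and let $X_{(1)}\le\dots\le X_{(N)}$ be their values in increasing order. Let $G_{(1)}\le\dots\le G_{(N-1)}$ be the $N-1$ inner spacings $X_{(j+1)}-X_{(j)}$ ($1\le j\le N-1$) in increasing order (the boundary points $0$ and $1$ are not used). Put $H(x,a,b)=1$ if $a\le x\le b$ and $H(x,a,b)=0$ otherwise, and $$f_{N,k}(x)=(-1)^k N(N-1)\binom{N-2}{k-1}\sum_{i=1}^{k}(-1)^i\binom{k-1}{i-1}\bigl[1-(N-i)x\bigr]^{N-1}H\!\left(x,0,\tfrac1{N-i}\right),\qquad x\in\mathbb R .$$ Then: 1. $f_{N,k}\ge 0$ everywhere, and the law of $G_{(k)}$ is absolutely continuous with respect to Lebesgue measure with density $f_{N,k}$. 2. For every $x\ge 0$, with the convention that an integral $\int_a^1$ with $a>1$ is $0$, $$f_{N,k}(x)=(-1)^k N(N-1)^2\binom{N-2}{k-1}\sum_{i=1}^{k}\int_{(N-i)x}^{1}(-1)^i\binom{k-1}{i-1}\bigl[\mu-(N-i)x\bigr]^{N-2}\,d\mu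 ,$$ and, if moreover $N\ge 3$, $$f_{N,k}(x)=(-1)^k N(N-1)^2(N-2)\binom{N-2}{k-1}\sum_{i=1}^{k}\int_{(N-i)x}^{1}(-1)^i\binom{k-1}{i-1}(1-\mu)\bigl[\mu-(N-i)x\bigr]^{N-3}\,d\mu .$$ 3. For every $x\ge 0$, $$P(G_{(k)}\le x)=(-1)^k (N-1)\binom{N-2}{k-1}\sum_{i=1}^{k}\frac{(-1)^i}{N-i}\binom{k-1}{i-1}\left(1-\bigl[1-(N-i)x\bigr]^{N}H\!\left(x,0,\tfrac1{N-i}\right)\right),$$ and $P(G_{(k)}\le x)=0$ for $x<0$. -/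

import Mathlib

open MeasureTheory ProbabilityTheory

noncomputable section

/-- The entries of `x` in increasing order (with multiplicity): `orderStat x j` is the
`(j + 1)`-st smallest entry of `x`. -/
def orderStat {n : ℕ} (x : Fin n → ℝ) : Fin n → ℝ := x ∘ Tuple.sort x

/-- The `N - 1` inner spacings of the points `x 0, …, x (N - 1)`: the distances between
consecutive points in increasing order. No boundary points are added. -/
def innerSpacing {N : ℕ} (x : Fin N → ℝ) : Fin (N - 1) → ℝ := fun j =>
  orderStat x ⟨(j : ℕ) + 1, by omega⟩ - orderStat x ⟨(j : ℕ), by omega⟩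

/-- The `k`-th smallest inner spacing, for `k = 1, …, N - 1`. -/
def kthInnerSpacing {N : ℕ} (k : ℕ) (hk : 1 ≤ k ∧ k < N) (x : Fin N → ℝ) : ℝ :=
  orderStat (innerSpacing x) ⟨k - 1, by omega⟩

/-- The window function: `1` if `a ≤ x ≤ b` and `0` otherwise. -/
def window (x a b : ℝ) : ℝ := (Set.Icc a b).indicator 1 x

/-- The closed form of the density of the `k`-th smallest inner spacing of `N` points. -/
def spacingDensity (N k : ℕ) (x : ℝ) : ℝ :=
  (-1) ^ k * N * (N - 1) * ((N - 2).choose (k - 1) : ℝ) *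
    ∑ i ∈ Finset.Icc 1 k, (-1) ^ i * ((k - 1).choose (i - 1) : ℝ) *
      (1 - ((N : ℝ) - i) * x) ^ (N - 1) * window x 0 (1 / ((N : ℝ) - i))

/-- The closed form of the distribution function of the `k`-th smallest inner spacing of `N`
points, on the half-line `0 ≤ x`. -/
def spacingCdf (N k : ℕ) (x : ℝ) : ℝ :=
  (-1) ^ k * (N - 1) * ((N - 2).choose (k - 1) : ℝ) *
    ∑ i ∈ Finset.Icc 1 k, (-1) ^ i / ((N : ℝ) - i) * ((k - 1).choose (i - 1) : ℝ) *
      (1 - (1 - ((N : ℝ) - i) * x) ^ N * window x 0 (1 / ((N : ℝ) - i)))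

end

/-! ### Order statistics -/

/-! The `k`-th smallest spacing exceeds `x ≥ 0` exactly when at least `N - k` of the `N - 1`
spacings do. Inclusion-exclusion (`measureReal_lt_card_filter`) reduces this to the probability that
every spacing in a given set `S` exceeds `x`, which is `max (1 - |S| x) 0 ^ N`
(`volume_innerSpacing_gt`). Indeed, by symmetry only increasing points matter, and closing up each
chosen gap by `x` is a translation onto the increasing points of a cube of side `1 - |S| x`; the
factors `N!` cancel.

Reindexing by `i = k - t` turns the tail into `1 - truncCdf` (`truncCdf_eq_one_sub`). As `N ≥ 2`,
truncated `N`-th powers are continuously differentiable, so `truncCdf` has derivative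
`truncDensity`. The density is nonnegative because a distribution function is monotone, and the
fundamental theorem of calculus identifies the law on half-lines. The integral formulas follow by
evaluating each integral as a truncated power. -/

lemma monotone_orderStat {n : ℕ} (x : Fin n → ℝ) : Monotone (orderStat x) :=
  Tuple.monotone_sort x

lemma orderStat_comp_perm {n : ℕ} (x : Fin n → ℝ) (σ : Equiv.Perm (Fin n)) :
    orderStat (x ∘ σ) = orderStat x :=
  Tuple.comp_perm_comp_sort_eq_comp_sort

lemma orderStat_of_monotone {n : ℕ} {x : Fin n → ℝ} (hx : Monotone x) : orderStat x = x := by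
  rw [orderStat, Tuple.sort_eq_refl_iff_monotone.2 hx]
  rfl

/-- Sorting preserves the number of entries at most `t`, and in a sorted tuple these entries form an
initial segment. -/
lemma orderStat_le_iff {n : ℕ} (x : Fin n → ℝ) (j : Fin n) (t : ℝ) :
    orderStat x j ≤ t ↔ (j : ℕ) < (Finset.univ.filter fun i => x i ≤ t).card := by
  have h := Tuple.lt_card_le_iff_apply_le_of_monotone (f := orderStat x) (a := t) (j := j)
    (monotone_orderStat x)
  rw [← h]
  have hc : (Finset.univ.filter fun i => orderStat x i ≤ t).card =
      (Finset.univ.filter fun i => x i ≤ t).card := by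
    refine Finset.card_bij (fun i _ => Tuple.sort x i) ?_ ?_ ?_
    · intro i hi
      simp only [Finset.mem_filter, Finset.mem_univ, true_and] at hi ⊢
      exact hi
    · intro i _ j _ hij
      exact (Tuple.sort x).injective hij
    · intro i hi
      refine ⟨(Tuple.sort x).symm i, ?_, by simp⟩
      simp only [Finset.mem_filter, Finset.mem_univ, true_and] at hi ⊢
      simpa only [orderStat, Function.comp, Equiv.apply_symm_apply] using hi
  rw [hc]

lemma lt_orderStat_iff {n : ℕ} (x : Fin n → ℝ) (j : Fin n) (t : ℝ) :
    t < orderStat x j ↔ n - j ≤ (Finset.univ.filter fun i => t < x i).card := by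
  rw [← not_le, orderStat_le_iff]
  have h := Finset.card_filter_add_card_filter_not (s := (Finset.univ : Finset (Fin n)))
    (fun i => x i ≤ t)
  simp only [not_le, Finset.card_univ, Fintype.card_fin] at h
  have := j.2
  omega

lemma measurable_orderStat {n : ℕ} (j : Fin n) :
    Measurable fun x : Fin n → ℝ => orderStat x j := by
  refine measurable_of_Iic fun t => ?_
  have h : Measurable fun x : Fin n → ℝ => (Finset.univ.filter fun i => x i ≤ t).card := by
    simp only [Finset.card_filter]
    refine Finset.measurable_sum _ fun i _ => ?_
    exact Measurable.ite (measurableSet_le (measurable_pi_apply i) measurable_const)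
      measurable_const measurable_const
  have : (fun x : Fin n → ℝ => orderStat x j) ⁻¹' Set.Iic t =
      {x | (j : ℕ) < (Finset.univ.filter fun i => x i ≤ t).card} := by
    ext x
    exact orderStat_le_iff x j t
  rw [this]
  exact measurableSet_lt measurable_const h

lemma measurable_innerSpacing {N : ℕ} :
    Measurable fun x : Fin N → ℝ => innerSpacing x :=
  measurable_pi_lambda _ fun _ => (measurable_orderStat _).sub (measurable_orderStat _)

lemma measurable_kthInnerSpacing {N : ℕ} (k : ℕ) (hk : 1 ≤ k ∧ k < N) :
    Measurable fun x : Fin N → ℝ => kthInnerSpacing k hk x :=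
  (measurable_orderStat _).comp measurable_innerSpacing

lemma innerSpacing_nonneg {N : ℕ} (x : Fin N → ℝ) (j : Fin (N - 1)) : 0 ≤ innerSpacing x j :=
  sub_nonneg.2 (monotone_orderStat x (by simp [Fin.le_def]))

lemma kthInnerSpacing_nonneg {N : ℕ} (k : ℕ) (hk : 1 ≤ k ∧ k < N) (x : Fin N → ℝ) :
    0 ≤ kthInnerSpacing k hk x :=
  innerSpacing_nonneg x _

lemma lt_kthInnerSpacing_iff {N : ℕ} (k : ℕ) (hk : 1 ≤ k ∧ k < N) (x : Fin N → ℝ) (t : ℝ) :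
    t < kthInnerSpacing k hk x ↔
      N - 1 - k + 1 ≤ (Finset.univ.filter fun j => t < innerSpacing x j).card := by
  rw [kthInnerSpacing, lt_orderStat_iff]
  have : N - 1 - (k - 1) = N - 1 - k + 1 := by omega
  simp only [this]

/-! ### Volumes of permutation-invariant sets -/

lemma ae_injective {n : ℕ} : ∀ᵐ x : Fin n → ℝ, Function.Injective x := by
  have h : ∀ i j : Fin n, i ≠ j → ∀ᵐ x : Fin n → ℝ, x i ≠ x j := by
    intro i j hij
    have h0 := Measure.addHaar_submodule (volume : Measure (Fin n → ℝ))
      (LinearMap.ker ((LinearMap.proj i : (Fin n → ℝ) →ₗ[ℝ] ℝ) - LinearMap.proj j)) (by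
        intro h
        rw [LinearMap.ker_eq_top] at h
        -- The functional takes the value `1` here, so its kernel is a proper subspace, hence null.
        have := LinearMap.congr_fun h (Pi.single i 1)
        simp [hij.symm] at this)
    rw [ae_iff]
    convert h0 using 2
    ext x
    simp [sub_eq_zero]
  have h' : ∀ᵐ x : Fin n → ℝ, ∀ i j : Fin n, i ≠ j → x i ≠ x j := by
    simp only [ae_all_iff]
    intro i j hij
    exact h i j hij
  filter_upwards [h'] with x hx i j hij
  by_contra hne
  exact hx i j hne hij

lemma measurableSet_strictMono_comp {n : ℕ} (σ : Equiv.Perm (Fin n)) :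
    MeasurableSet {x : Fin n → ℝ | StrictMono (x ∘ σ)} := by
  simp only [StrictMono, Set.ofPred_forall, Function.comp]
  refine MeasurableSet.iInter fun i => MeasurableSet.iInter fun j => MeasurableSet.iInter fun _ => ?_
  exact measurableSet_lt (measurable_pi_apply _) (measurable_pi_apply _)

/-- A permutation-invariant set has `n!` times the volume of its strictly increasing part. -/
lemma volume_eq_factorial_mul_strictMono {n : ℕ} {E : Set (Fin n → ℝ)} (hE : MeasurableSet E)
    (hperm : ∀ (σ : Equiv.Perm (Fin n)) x, x ∘ σ ∈ E ↔ x ∈ E) :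
    volume E = n.factorial * volume (E ∩ {x | StrictMono x}) := by
  have hpart : ∀ σ : Equiv.Perm (Fin n),
      volume (E ∩ {x | StrictMono (x ∘ σ)}) = volume (E ∩ {x | StrictMono x}) := by
    intro σ
    have hmp := volume_preserving_arrowCongr' (σ.symm) (MeasurableEquiv.refl ℝ)
      (MeasurePreserving.id _)
    rw [← hmp.measure_preimage_equiv (E ∩ {x | StrictMono x})]
    congr 1
    ext x
    have hx : MeasurableEquiv.arrowCongr' σ.symm (MeasurableEquiv.refl ℝ) x = x ∘ σ := by
      ext i
      simp [MeasurableEquiv.arrowCongr', Equiv.arrowCongr']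
    simp only [Set.mem_preimage, Set.mem_inter_iff, Set.mem_ofPred_eq, hx, hperm]
  -- A point with distinct coordinates is sorted by exactly one permutation, so these pieces
  -- partition `E` up to a null set.
  have hunion : E =ᵐ[volume] ⋃ σ : Equiv.Perm (Fin n), E ∩ {x | StrictMono (x ∘ σ)} := by
    filter_upwards [ae_injective (n := n)] with x hx
    apply propext
    change x ∈ E ↔ x ∈ ⋃ σ : Equiv.Perm (Fin n), E ∩ {x | StrictMono (x ∘ σ)}
    simp only [Set.mem_iUnion, Set.mem_inter_iff, Set.mem_ofPred_eq]
    exact ⟨fun h => ⟨Tuple.sort x, h, (Tuple.monotone_sort x).strictMono_of_injective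
      (hx.comp (Tuple.sort x).injective)⟩, fun ⟨_, h, _⟩ => h⟩
  rw [measure_congr hunion, measure_iUnion]
  · simp [hpart, tsum_fintype, Fintype.card_perm]
  · intro σ τ hne
    refine Set.disjoint_left.2 fun x hσ hτ => hne ?_
    have h := Tuple.unique_monotone hσ.2.monotone hτ.2.monotone
    have hx : Function.Injective x := by
      have := hσ.2.injective.comp σ.symm.injective
      simpa [Function.comp_assoc] using this
    exact Equiv.ext fun i => hx (congrFun h i)
  · exact fun σ => hE.inter (measurableSet_strictMono_comp σ)

/-! ### The joint tail of the spacings -/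

lemma volume_cube {n : ℕ} (L : ℝ) :
    volume {y : Fin n → ℝ | ∀ i, y i ∈ Set.Icc 0 L} = ENNReal.ofReal L ^ n := by
  have : {y : Fin n → ℝ | ∀ i, y i ∈ Set.Icc 0 L} = Set.univ.pi fun _ => Set.Icc 0 L := by
    ext
    simp only [Set.mem_ofPred_eq, Set.mem_univ_pi]
  rw [this, volume_pi_pi]
  simp

lemma measurableSet_cube {n : ℕ} (L : ℝ) :
    MeasurableSet {y : Fin n → ℝ | ∀ i, y i ∈ Set.Icc 0 L} := by
  rw [Set.ofPred_forall]
  exact MeasurableSet.iInter fun i => measurableSet_Icc.preimage (measurable_pi_apply i)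

/-- The displacement that closes up the gaps indexed by `S` by the amount `t`. -/
def gapShift {n : ℕ} (S : Finset (Fin n)) (t : ℝ) (i : Fin (n + 1)) : ℝ :=
  (S.filter fun j => j.castSucc < i).card * t

lemma gapShift_zero {n : ℕ} (S : Finset (Fin n)) (t : ℝ) : gapShift S t 0 = 0 := by
  simp [gapShift]

lemma gapShift_last {n : ℕ} (S : Finset (Fin n)) (t : ℝ) :
    gapShift S t (Fin.last n) = S.card * t := by
  simp [gapShift, Fin.castSucc_lt_last]

lemma gapShift_succ {n : ℕ} (S : Finset (Fin n)) (t : ℝ) (j : Fin n) :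
    gapShift S t j.succ = gapShift S t j.castSucc + if j ∈ S then t else 0 := by
  have h : (S.filter fun l => l.castSucc < j.succ) =
      (S.filter fun l => l.castSucc < j.castSucc) ∪ S.filter fun l => l = j := by
    ext l
    simp only [Finset.mem_filter, Finset.mem_union, Fin.lt_def, Fin.ext_iff, Fin.val_castSucc,
      Fin.val_succ]
    grind
  have hd : Disjoint (S.filter fun l => l.castSucc < j.castSucc) (S.filter fun l => l = j) := by
    refine Finset.disjoint_left.2 fun l h1 h2 => ?_
    simp only [Finset.mem_filter] at h1 h2
    exact absurd h1.2 (by simp [h2.2])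
  rw [gapShift, gapShift, h, Finset.card_union_of_disjoint hd, Finset.filter_eq']
  split_ifs <;> simp; ring

/-- The shift shortens each gap in `S` by `t`, keeps the other gaps and the first point, and lowers
the last point by `S.card * t`. For increasing tuples the box constraints need checking only at the
two end points. -/
lemma strictMono_gaps_iff {n : ℕ} (S : Finset (Fin n)) {t : ℝ} (ht : 0 ≤ t)
    (u : Fin (n + 1) → ℝ) :
    ((∀ i, u i ∈ Set.Icc 0 1) ∧ (∀ j ∈ S, t < u j.succ - u j.castSucc) ∧ StrictMono u) ↔
      ((∀ i, (u - gapShift S t) i ∈ Set.Icc 0 (1 - S.card * t)) ∧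
        StrictMono (u - gapShift S t)) := by
  have h0 := gapShift_zero S t
  have hl := gapShift_last S t
  have hs := gapShift_succ S t
  constructor
  · rintro ⟨hI, hS, hu⟩
    have hm : StrictMono (u - gapShift S t) := by
      refine Fin.strictMono_iff_lt_succ.2 fun j => ?_
      have h1 := hu (Fin.castSucc_lt_succ (i := j))
      simp only [Pi.sub_apply, hs]
      split_ifs with hj
      · have := hS j hj
        linarith
      · linarith
    refine ⟨fun i => ⟨?_, ?_⟩, hm⟩
    · refine le_trans ?_ (hm.monotone (Fin.zero_le i))
      simpa [h0] using (hI 0).1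
    · refine (hm.monotone (Fin.le_last i)).trans ?_
      simpa [hl] using (hI (Fin.last n)).2
  · rintro ⟨hI, hm⟩
    have hstep : ∀ j : Fin n, (if j ∈ S then t else 0) < u j.succ - u j.castSucc := by
      intro j
      have h1 := hm (Fin.castSucc_lt_succ (i := j))
      simp only [Pi.sub_apply, hs] at h1
      linarith
    have hu : StrictMono u := by
      refine Fin.strictMono_iff_lt_succ.2 fun j => ?_
      have := hstep j
      split_ifs at this <;> linarith
    refine ⟨fun i => ⟨?_, ?_⟩, fun j hj => by simpa [hj] using hstep j, hu⟩
    · refine le_trans ?_ (hu.monotone (Fin.zero_le i))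
      simpa [h0] using (hI 0).1
    · refine (hu.monotone (Fin.le_last i)).trans ?_
      simpa [hl] using (hI (Fin.last n)).2

lemma measurableSet_innerSpacing_gt {n : ℕ} (S : Finset (Fin n)) (t : ℝ) :
    MeasurableSet {u : Fin (n + 1) → ℝ | ∀ j ∈ S, t < innerSpacing u j} := by
  simp only [Set.ofPred_forall]
  refine MeasurableSet.iInter fun j => MeasurableSet.iInter fun _ => ?_
  exact measurableSet_lt measurable_const (measurable_pi_iff.1 (measurable_innerSpacing (N := n + 1)) j)

/-- The volume of the points of the unit cube whose spacings indexed by `S` exceed `t`. -/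
lemma volume_innerSpacing_gt {n : ℕ} (S : Finset (Fin n)) {t : ℝ} (ht : 0 ≤ t) :
    volume ({u : Fin (n + 1) → ℝ | ∀ j ∈ S, t < innerSpacing u j} ∩
      {u | ∀ i, u i ∈ Set.Icc 0 1}) = ENNReal.ofReal (1 - S.card * t) ^ (n + 1) := by
  rw [← volume_cube, volume_eq_factorial_mul_strictMono (measurableSet_cube _),
    volume_eq_factorial_mul_strictMono
      ((measurableSet_innerSpacing_gt S t).inter (measurableSet_cube _))]
  · congr 1
    -- With the factorials cancelled, the two increasing parts are translates of each other.
    rw [← measure_preimage_add_right volume (-gapShift S t)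
      ({y | ∀ i, y i ∈ Set.Icc 0 (1 - S.card * t)} ∩ {x | StrictMono x})]
    congr 1
    ext u
    have h := strictMono_gaps_iff S ht u
    simp only [Set.mem_inter_iff, Set.mem_ofPred_eq, Set.mem_preimage, ← sub_eq_add_neg]
    rw [← h]
    have key : StrictMono u → innerSpacing u = fun j : Fin n => u j.succ - u j.castSucc := by
      intro hu
      funext j
      rw [innerSpacing, orderStat_of_monotone hu.monotone]
      rfl
    constructor
    · rintro ⟨⟨h1, h2⟩, h3⟩
      rw [key h3] at h1
      exact ⟨h2, h1, h3⟩
    · rintro ⟨h1, h2, h3⟩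
      rw [key h3]
      exact ⟨⟨h2, h1⟩, h3⟩
  · intro σ x
    have : innerSpacing (x ∘ σ) = innerSpacing x := by
      unfold innerSpacing
      rw [orderStat_comp_perm]
    simp only [Set.mem_inter_iff, Set.mem_ofPred_eq, this, Function.comp]
    rw [σ.forall_congr_left]
    simp
  · intro σ x
    simp only [Set.mem_ofPred_eq, Function.comp]
    rw [σ.forall_congr_left]
    simp

/-! ### Inclusion and exclusion -/

/-- By Pascal's rule, passing from `c` to `c + 1` adds `c.choose p` times an alternating row sum of
binomials, which is zero unless `c = p`; so the value jumps once, from `0` to `1`. The bound `hc`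
ensures that the range cuts off no nonzero term. -/
lemma sum_neg_one_pow_choose_mul_choose (p T c : ℕ) (hc : c ≤ p + T) :
    ∑ t ∈ Finset.range T, (-1 : ℝ) ^ t * ((p + t).choose p : ℝ) * (c.choose (p + 1 + t) : ℝ) =
      if p + 1 ≤ c then 1 else 0 := by
  induction c with
  | zero =>
    rw [if_neg (by omega)]
    refine Finset.sum_eq_zero fun t _ => ?_
    rw [Nat.choose_eq_zero_of_lt (by omega : 0 < p + 1 + t)]
    simp
  | succ c ih =>
    have hstep : ∀ t, (-1 : ℝ) ^ t * ((p + t).choose p : ℝ) * ((c + 1).choose (p + 1 + t) : ℝ) =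
        (c.choose p : ℝ) * ((-1) ^ t * ((c - p).choose t : ℝ)) +
          (-1 : ℝ) ^ t * ((p + t).choose p : ℝ) * (c.choose (p + 1 + t) : ℝ) := by
      intro t
      have h1 : (c + 1).choose (p + 1 + t) = c.choose (p + t) + c.choose (p + 1 + t) := by
        rw [show p + 1 + t = p + t + 1 by ring]
        exact Nat.choose_succ_succ c (p + t)
      have h2 : c.choose (p + t) * (p + t).choose p = c.choose p * (c - p).choose t := by
        rw [Nat.choose_mul (Nat.le_add_right p t)]
        simp
      have h2' : (c.choose (p + t) : ℝ) * ((p + t).choose p : ℝ) =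
          (c.choose p : ℝ) * ((c - p).choose t : ℝ) := by exact_mod_cast h2
      rw [h1]
      push_cast
      linear_combination (-1 : ℝ) ^ t * h2'
    simp_rw [hstep]
    rw [Finset.sum_add_distrib, ih (by omega), ← Finset.mul_sum]
    rcases lt_trichotomy c p with h | h | h
    · rw [Nat.choose_eq_zero_of_lt h, if_neg (by omega), if_neg (by omega)]
      simp
    · subst h
      have : ∑ t ∈ Finset.range T, (-1 : ℝ) ^ t * ((0 : ℕ).choose t : ℝ) = 1 := by
        rw [Finset.sum_eq_single 0]
        · simp
        · intro t _ ht
          rw [Nat.choose_eq_zero_of_lt (by omega)]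
          simp
        · intro h0
          simp at h0
          omega
      simp [this]
    · have : ∑ t ∈ Finset.range T, (-1 : ℝ) ^ t * ((c - p).choose t : ℝ) = 0 := by
        have hz := Int.alternating_sum_range_choose_of_ne (n := c - p) (by omega)
        have hsub : Finset.range (c - p + 1) ⊆ Finset.range T := by
          intro a
          simp only [Finset.mem_range]
          omega
        rw [← Finset.sum_subset hsub]
        · exact_mod_cast hz
        · intro t _ ht
          rw [Finset.mem_range] at ht
          rw [Nat.choose_eq_zero_of_lt (by omega)]
          simp
      rw [this, if_pos (by omega), if_pos (by omega)]
      simp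

/-- The probability that more than `p` of the `n = p + T` events `{ω | A j ω}` occur. -/
lemma measureReal_lt_card_filter {α : Type*} [MeasurableSpace α] (μ : Measure α)
    [IsFiniteMeasure μ] {n p T : ℕ} (hn : n = p + T) (A : Fin n → Set α)
    [∀ ω, DecidablePred fun j => ω ∈ A j]
    (hA : ∀ j, MeasurableSet (A j)) :
    μ.real {ω | p + 1 ≤ (Finset.univ.filter fun j => ω ∈ A j).card} =
      ∑ t ∈ Finset.range T, (-1 : ℝ) ^ t * ((p + t).choose p : ℝ) *
        ∑ S ∈ Finset.univ.powersetCard (p + 1 + t), μ.real {ω | ∀ j ∈ S, ω ∈ A j} := by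
  have hS : ∀ S : Finset (Fin n), MeasurableSet {ω | ∀ j ∈ S, ω ∈ A j} := by
    intro S
    simp only [Set.ofPred_forall]
    exact MeasurableSet.iInter fun j => MeasurableSet.iInter fun _ => hA j
  have hcard : Measurable fun ω => (Finset.univ.filter fun j => ω ∈ A j).card := by
    simp only [Finset.card_filter]
    exact Finset.measurable_sum _ fun j _ =>
      Measurable.ite (hA j) measurable_const measurable_const
  have hpt : ∀ ω, {ω | p + 1 ≤ (Finset.univ.filter fun j => ω ∈ A j).card}.indicator
      (1 : α → ℝ) ω = ∑ t ∈ Finset.range T, (-1 : ℝ) ^ t * ((p + t).choose p : ℝ) *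
        ∑ S ∈ Finset.univ.powersetCard (p + 1 + t),
          {ω | ∀ j ∈ S, ω ∈ A j}.indicator (1 : α → ℝ) ω := by
    intro ω
    have hc : (Finset.univ.filter fun j => ω ∈ A j).card ≤ p + T := by
      rw [← hn]
      simpa using Finset.card_le_univ (Finset.univ.filter fun j => ω ∈ A j)
    -- The sets `S` that contribute are the `r`-subsets of the set of events that occur at `ω`.
    have hin : ∀ r, ∑ S ∈ Finset.univ.powersetCard r,
        {ω | ∀ j ∈ S, ω ∈ A j}.indicator (1 : α → ℝ) ω =
          ((Finset.univ.filter fun j => ω ∈ A j).card.choose r : ℝ) := by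
      intro r
      rw [← Finset.card_powersetCard]
      simp only [Set.indicator_apply, Set.mem_ofPred_eq, Pi.one_apply]
      rw [Finset.sum_boole]
      congr 2
      ext S
      simp only [Finset.mem_filter, Finset.mem_powersetCard, true_and,
        Finset.subset_iff, Finset.mem_univ]
      tauto
    simp_rw [hin]
    rw [sum_neg_one_pow_choose_mul_choose _ _ _ hc]
    simp [Set.indicator_apply]
  rw [← integral_indicator_one (measurableSet_le measurable_const hcard)]
  simp_rw [hpt]
  have hint : ∀ S : Finset (Fin n),
      Integrable ({ω | ∀ j ∈ S, ω ∈ A j}.indicator (1 : α → ℝ)) μ :=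
    fun S => (integrable_const (1 : ℝ)).indicator (hS S)
  rw [integral_finsetSum _ fun t _ => (integrable_finsetSum _ fun S _ => hint S).const_mul _]
  refine Finset.sum_congr rfl fun t _ => ?_
  rw [integral_const_mul, integral_finsetSum _ fun S _ => hint S]
  simp_rw [integral_indicator_one (hS _)]

/-- The coefficients of the inclusion-exclusion formula in their symmetric form. -/
lemma neg_one_pow_mul_choose_mul_choose_eq (p k t : ℕ) (ht : t < k) :
    (-1 : ℝ) ^ k * ((p + k : ℕ) : ℝ) * ((p + k - 1).choose (k - 1) : ℝ) *
      ((-1) ^ (k - t) / ((p + 1 + t : ℕ) : ℝ) * ((k - 1).choose (k - t - 1) : ℝ)) =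
    (-1) ^ t * ((p + t).choose p : ℝ) * ((p + k).choose (p + 1 + t) : ℝ) := by
  -- With `s = k - 1 - t` all natural subtractions disappear and every binomial becomes a quotient
  -- of factorials.
  obtain ⟨s, rfl⟩ : ∃ s, k = s + t + 1 := ⟨k - 1 - t, by omega⟩
  have e1 : p + (s + t + 1) - 1 = (s + t) + p := by omega
  have e2 : s + t + 1 - 1 = s + t := by omega
  have e3 : s + t + 1 - t - 1 = s := by omega
  have e4 : s + t + 1 - t = s + 1 := by omega
  have e5 : p + (s + t + 1) = (p + 1 + t) + s := by omega
  rw [e1, e2, e3, e4, e5, Nat.cast_add_choose, Nat.cast_add_choose, Nat.cast_add_choose,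
    Nat.cast_add_choose]
  have f1 : ((p + 1 + t).factorial : ℝ) = ((p + 1 + t : ℕ) : ℝ) * (p + t).factorial := by
    rw [show p + 1 + t = (p + t) + 1 by ring, Nat.factorial_succ]
    push_cast
    ring
  have f2 : ((p + 1 + t + s).factorial : ℝ) =
      ((p + 1 + t + s : ℕ) : ℝ) * (s + t + p).factorial := by
    rw [show p + 1 + t + s = (s + t + p) + 1 by ring, Nat.factorial_succ]
    push_cast
    ring
  rw [f1, f2]
  have hsgn : (-1 : ℝ) ^ (s + t + 1) * (-1) ^ (s + 1) = (-1) ^ t := by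
    rw [← pow_add, show s + t + 1 + (s + 1) = t + 2 * (s + 1) by ring, pow_add, pow_mul]
    simp
  rw [← hsgn]
  have h0 : ((p + 1 + t : ℕ) : ℝ) ≠ 0 := by positivity
  have := fun n : ℕ => (Nat.cast_ne_zero (R := ℝ)).2 n.factorial_ne_zero
  have g1 := this p
  have g2 := this s
  have g3 := this t
  have g4 := this (p + t)
  have g5 := this (s + t)
  field_simp

/-! ### Truncated powers -/

/-- The exponent is at least `2`, so both one-sided derivatives at the kink vanish. -/
lemma hasDerivAt_max_zero_pow (m : ℕ) (y : ℝ) :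
    HasDerivAt (fun y : ℝ => max y 0 ^ (m + 2)) ((m + 2) * max y 0 ^ (m + 1)) y := by
  have hp : ∀ z : ℝ, HasDerivAt (fun y : ℝ => y ^ (m + 2)) ((m + 2) * z ^ (m + 1)) z := by
    intro z
    simpa using hasDerivAt_pow (m + 2) z
  rcases lt_trichotomy y 0 with h | rfl | h
  · rw [max_eq_right h.le]
    have : HasDerivAt (fun _ : ℝ => (0 : ℝ)) ((m + 2) * 0 ^ (m + 1)) y := by
      simpa using hasDerivAt_const y (0 : ℝ)
    refine this.congr_of_eventuallyEq ?_
    filter_upwards [Iio_mem_nhds h] with z hz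
    rw [max_eq_right (le_of_lt hz)]
    simp
  · rw [← hasDerivWithinAt_univ, ← Set.Iic_union_Ici (a := (0 : ℝ))]
    refine HasDerivWithinAt.union ?_ ?_
    · have : HasDerivWithinAt (fun _ : ℝ => (0 : ℝ)) ((m + 2) * max 0 0 ^ (m + 1))
          (Set.Iic 0) 0 := by
        simpa using hasDerivWithinAt_const (0 : ℝ) (Set.Iic 0) (0 : ℝ)
      refine this.congr (fun z hz => ?_) (by simp)
      rw [max_eq_right hz]
      simp
    · have := (hp 0).hasDerivWithinAt (s := Set.Ici 0)
      rw [max_self]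
      refine this.congr (fun z hz => ?_) (by simp)
      rw [max_eq_left hz]
  · rw [max_eq_left h.le]
    refine (hp y).congr_of_eventuallyEq ?_
    filter_upwards [Ioi_mem_nhds h] with z hz
    rw [max_eq_left (le_of_lt hz)]

lemma hasDerivAt_max_one_sub_mul_pow (m : ℕ) (a x : ℝ) :
    HasDerivAt (fun x : ℝ => max (1 - a * x) 0 ^ (m + 2))
      (-(a * (m + 2) * max (1 - a * x) 0 ^ (m + 1))) x := by
  have h1 : HasDerivAt (fun x : ℝ => 1 - a * x) (-a) x := by
    simpa using ((hasDerivAt_id x).const_mul a).const_sub 1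
  have := (hasDerivAt_max_zero_pow m (1 - a * x)).comp x h1
  refine this.congr_deriv ?_
  ring

/-- For `x ≥ 0` the window cuts off exactly where `1 - a * x` turns negative; `m ≠ 0` makes the
truncated power vanish there. -/
lemma pow_mul_window_eq {a x : ℝ} (ha : 0 < a) (hx : 0 ≤ x) {m : ℕ} (hm : m ≠ 0) :
    (1 - a * x) ^ m * window x 0 (1 / a) = max (1 - a * x) 0 ^ m := by
  rw [window, Set.indicator_apply]
  by_cases h : x ≤ 1 / a
  · rw [if_pos ⟨hx, h⟩, max_eq_left]
    · simp
    · rw [le_div_iff₀ ha] at h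
      linarith
  · rw [if_neg fun h' => h h'.2, max_eq_right]
    · simp [hm]
    · rw [not_le, div_lt_iff₀ ha] at h
      linarith

lemma integral_Icc_sub_pow (c : ℝ) (m : ℕ) :
    ∫ μ in Set.Icc c 1, (μ - c) ^ m = max (1 - c) 0 ^ (m + 1) / (m + 1) := by
  rcases le_or_gt c 1 with h | h
  · rw [integral_Icc_eq_integral_Ioc, ← intervalIntegral.integral_of_le h,
      intervalIntegral.integral_comp_sub_right (fun μ => μ ^ m) c, integral_pow,
      max_eq_left (by linarith)]
    simp
  · rw [Set.Icc_eq_empty (by linarith), max_eq_right (by linarith)]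
    simp

lemma integral_Icc_one_sub_mul_sub_pow (c : ℝ) (m : ℕ) :
    ∫ μ in Set.Icc c 1, (1 - μ) * (μ - c) ^ m =
      max (1 - c) 0 ^ (m + 2) / ((m + 1) * (m + 2)) := by
  have hI : ∀ r : ℕ, IntegrableOn (fun μ : ℝ => (μ - c) ^ r) (Set.Icc c 1) := fun r =>
    (by fun_prop : Continuous fun μ : ℝ => (μ - c) ^ r).continuousOn.integrableOn_Icc
  -- Writing `1 - μ = (1 - c) - (μ - c)` leaves only pure powers of `μ - c`.
  have h : ∀ μ : ℝ, (1 - μ) * (μ - c) ^ m = (1 - c) * (μ - c) ^ m - (μ - c) ^ (m + 1) := by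
    intro μ
    ring
  simp_rw [h]
  rw [integral_sub ((hI m).const_mul _) (hI (m + 1)), integral_const_mul, integral_Icc_sub_pow,
    integral_Icc_sub_pow]
  have hc : (1 - c) * max (1 - c) 0 ^ (m + 1) = max (1 - c) 0 ^ (m + 2) := by
    rcases le_or_gt c 1 with h | h
    · rw [max_eq_left (by linarith)]
      ring
    · rw [max_eq_right (by linarith)]
      simp
  push_cast
  rw [show m + 1 + 1 = m + 2 by rfl, ← hc]
  have h1 : (m : ℝ) + 1 ≠ 0 := by positivity
  have h2 : (m : ℝ) + 2 ≠ 0 := by positivity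
  have h3 : (m : ℝ) + 1 + 1 ≠ 0 := by positivity
  field_simp
  ring

/-! ### The closed forms on the half-line -/

/-- The density with the window functions replaced by truncations. -/
noncomputable def truncDensity (N k : ℕ) (x : ℝ) : ℝ :=
  (-1) ^ k * N * (N - 1) * ((N - 2).choose (k - 1) : ℝ) *
    ∑ i ∈ Finset.Icc 1 k, (-1) ^ i * ((k - 1).choose (i - 1) : ℝ) *
      max (1 - ((N : ℝ) - i) * x) 0 ^ (N - 1)

/-- The distribution function with the window functions replaced by truncations. -/
noncomputable def truncCdf (N k : ℕ) (x : ℝ) : ℝ :=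
  (-1) ^ k * (N - 1) * ((N - 2).choose (k - 1) : ℝ) *
    ∑ i ∈ Finset.Icc 1 k, (-1) ^ i / ((N : ℝ) - i) * ((k - 1).choose (i - 1) : ℝ) *
      (1 - max (1 - ((N : ℝ) - i) * x) 0 ^ N)

lemma sub_pos_of_mem_Icc {N k i : ℕ} (hk : k < N) (hi : i ∈ Finset.Icc 1 k) :
    0 < (N : ℝ) - i := by
  have : i < N := (Finset.mem_Icc.1 hi).2.trans_lt hk
  exact sub_pos.2 (by exact_mod_cast this)

lemma spacingDensity_eq_truncDensity {N k : ℕ} (hk : 1 ≤ k ∧ k < N) {x : ℝ} (hx : 0 ≤ x) :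
    spacingDensity N k x = truncDensity N k x := by
  rw [spacingDensity, truncDensity]
  congr 1
  refine Finset.sum_congr rfl fun i hi => ?_
  rw [mul_assoc, pow_mul_window_eq (sub_pos_of_mem_Icc hk.2 hi) hx (by omega)]

lemma spacingCdf_eq_truncCdf {N k : ℕ} (hk : 1 ≤ k ∧ k < N) {x : ℝ} (hx : 0 ≤ x) :
    spacingCdf N k x = truncCdf N k x := by
  rw [spacingCdf, truncCdf]
  congr 1
  refine Finset.sum_congr rfl fun i hi => ?_
  rw [pow_mul_window_eq (sub_pos_of_mem_Icc hk.2 hi) hx (by omega)]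

lemma spacingDensity_of_neg (N k : ℕ) {x : ℝ} (hx : x < 0) : spacingDensity N k x = 0 := by
  rw [spacingDensity]
  rw [Finset.sum_eq_zero fun i _ => ?_, mul_zero]
  rw [window, Set.indicator_of_notMem (fun h => (h.1.trans_lt hx).false), mul_zero]

lemma hasDerivAt_truncCdf {N k : ℕ} (hk : 1 ≤ k ∧ k < N) (x : ℝ) :
    HasDerivAt (truncCdf N k) (truncDensity N k x) x := by
  obtain ⟨m, rfl⟩ : ∃ m, N = m + 2 := ⟨N - 2, by omega⟩
  have h : HasDerivAt (truncCdf (m + 2) k) ((-1) ^ k * ((m + 2 : ℕ) - 1) *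
      ((m + 2 - 2).choose (k - 1) : ℝ) * ∑ i ∈ Finset.Icc 1 k,
        (-1) ^ i / (((m + 2 : ℕ) : ℝ) - i) * ((k - 1).choose (i - 1) : ℝ) *
          - -((((m + 2 : ℕ) : ℝ) - i) * (m + 2) *
            max (1 - (((m + 2 : ℕ) : ℝ) - i) * x) 0 ^ (m + 1))) x := by
    unfold truncCdf
    refine HasDerivAt.const_mul _ (HasDerivAt.fun_sum fun i _ => HasDerivAt.const_mul _ ?_)
    exact (hasDerivAt_max_one_sub_mul_pow m _ x).const_sub 1
  refine h.congr_deriv ?_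
  rw [truncDensity, Finset.mul_sum, Finset.mul_sum]
  refine Finset.sum_congr rfl fun i hi => ?_
  have h0 := (sub_pos_of_mem_Icc hk.2 hi).ne'
  rw [show m + 2 - 1 = m + 1 by omega]
  field_simp
  push_cast
  ring

lemma continuous_truncDensity (N k : ℕ) : Continuous (truncDensity N k) := by
  unfold truncDensity
  fun_prop

lemma truncCdf_zero (N k : ℕ) : truncCdf N k 0 = 0 := by
  simp [truncCdf]

lemma integral_truncDensity {N k : ℕ} (hk : 1 ≤ k ∧ k < N) (x : ℝ) :
    ∫ y in (0 : ℝ)..x, truncDensity N k y = truncCdf N k x := by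
  rw [intervalIntegral.integral_eq_sub_of_hasDerivAt (fun y _ => hasDerivAt_truncCdf hk y)
    ((continuous_truncDensity N k).intervalIntegrable _ _), truncCdf_zero, sub_zero]

/-- The sign is not visible in the alternating sum, so it is read off from monotonicity; the
derivative within `Set.Ici 0` also covers the end point `0`. -/
lemma truncDensity_nonneg_of_monotoneOn {N k : ℕ} (hk : 1 ≤ k ∧ k < N)
    (h : MonotoneOn (truncCdf N k) (Set.Ici 0)) {x : ℝ} (hx : 0 ≤ x) :
    0 ≤ truncDensity N k x := by
  rw [← (hasDerivAt_truncCdf hk x).hasDerivWithinAt.derivWithin (uniqueDiffOn_Ici 0 x hx)]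
  exact h.derivWithin_nonneg

lemma spacingDensity_eq_sum_integral {N k : ℕ} (hk : 1 ≤ k ∧ k < N) {x : ℝ} (hx : 0 ≤ x) :
    spacingDensity N k x =
      (-1) ^ k * N * ((N : ℝ) - 1) ^ 2 * ((N - 2).choose (k - 1) : ℝ) *
        ∑ i ∈ Finset.Icc 1 k, ∫ μ in Set.Icc (((N : ℝ) - i) * x) 1,
          (-1) ^ i * ((k - 1).choose (i - 1) : ℝ) * (μ - ((N : ℝ) - i) * x) ^ (N - 2) := by
  rw [spacingDensity_eq_truncDensity hk hx, truncDensity, Finset.mul_sum, Finset.mul_sum]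
  refine Finset.sum_congr rfl fun i _ => ?_
  obtain ⟨m, rfl⟩ : ∃ m, N = m + 2 := ⟨N - 2, by omega⟩
  rw [integral_const_mul, integral_Icc_sub_pow, show m + 2 - 2 = m by omega,
    show m + 2 - 1 = m + 1 by omega]
  push_cast
  have h1 : (m : ℝ) + 1 ≠ 0 := by positivity
  field_simp
  ring

lemma spacingDensity_eq_sum_integral_one_sub {N k : ℕ} (hk : 1 ≤ k ∧ k < N) (hN : 3 ≤ N)
    {x : ℝ} (hx : 0 ≤ x) :
    spacingDensity N k x =
      (-1) ^ k * N * ((N : ℝ) - 1) ^ 2 * ((N : ℝ) - 2) * ((N - 2).choose (k - 1) : ℝ) *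
        ∑ i ∈ Finset.Icc 1 k, ∫ μ in Set.Icc (((N : ℝ) - i) * x) 1,
          (-1) ^ i * ((k - 1).choose (i - 1) : ℝ) * (1 - μ) *
            (μ - ((N : ℝ) - i) * x) ^ (N - 3) := by
  rw [spacingDensity_eq_truncDensity hk hx, truncDensity, Finset.mul_sum, Finset.mul_sum]
  refine Finset.sum_congr rfl fun i _ => ?_
  obtain ⟨m, rfl⟩ : ∃ m, N = m + 3 := ⟨N - 3, by omega⟩
  simp_rw [mul_assoc ((-1 : ℝ) ^ i * ((k - 1).choose (i - 1) : ℝ))]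
  rw [integral_const_mul, show m + 3 - 3 = m by omega, integral_Icc_one_sub_mul_sub_pow,
    show m + 3 - 1 = m + 2 by omega]
  push_cast
  have h1 : (m : ℝ) + 1 ≠ 0 := by positivity
  have h2 : (m : ℝ) + 2 ≠ 0 := by positivity
  field_simp
  ring

/-! ### The law of the spacings of independent uniform points -/

lemma aemeasurable_of_isUniform_Icc {Ω : Type*} [MeasurableSpace Ω] {P : Measure Ω} {Y : Ω → ℝ}
    (h : pdf.IsUniform Y (Set.Icc (0 : ℝ) 1) P volume) : AEMeasurable Y P :=
  pdf.IsUniform.aemeasurable (by simp) (by simp) h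

lemma map_eq_restrict_cube {Ω : Type*} [MeasurableSpace Ω] {P : Measure Ω}
    [IsProbabilityMeasure P] {N : ℕ} {X : Fin N → Ω → ℝ} (hindep : iIndepFun X P)
    (hunif : ∀ j, pdf.IsUniform (X j) (Set.Icc (0 : ℝ) 1) P volume) :
    P.map (fun ω j => X j ω) = volume.restrict {u | ∀ i, u i ∈ Set.Icc 0 1} := by
  rw [(iIndepFun_iff_map_fun_eq_pi_map fun j => aemeasurable_of_isUniform_Icc (hunif j)).1 hindep]
  have h : ∀ j, P.map (X j) = volume.restrict (Set.Icc 0 1) := by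
    intro j
    -- The interval has length `1`, so the normalising factor is trivial.
    rw [hunif j, ProbabilityTheory.cond]
    simp
  simp_rw [h]
  rw [← Measure.restrict_pi_pi]
  congr 1
  ext
  simp only [Set.mem_ofPred_eq, Set.mem_univ_pi]

/-- The tail of the `k`-th smallest inner spacing by inclusion and exclusion, `n = p + k`. -/
lemma measureReal_lt_kthInnerSpacing {p k : ℕ} (hk : 1 ≤ k ∧ k < p + k + 1) {x : ℝ}
    (hx : 0 ≤ x) :
    (volume.restrict {u : Fin (p + k + 1) → ℝ | ∀ i, u i ∈ Set.Icc 0 1}).real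
        {u | x < kthInnerSpacing k hk u} =
      ∑ t ∈ Finset.range k, (-1 : ℝ) ^ t * ((p + t).choose p : ℝ) *
        ((p + k).choose (p + 1 + t) * max (1 - (p + 1 + t : ℕ) * x) 0 ^ (p + k + 1)) := by
  classical
  have hfin : IsFiniteMeasure
      (volume.restrict {u : Fin (p + k + 1) → ℝ | ∀ i, u i ∈ Set.Icc 0 1}) := by
    refine ⟨?_⟩
    rw [Measure.restrict_apply_univ, volume_cube]
    simp
  have hmem : {u : Fin (p + k + 1) → ℝ | x < kthInnerSpacing k hk u} =
      {u | p + 1 ≤ (Finset.univ.filter fun j : Fin (p + k) =>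
        u ∈ {u : Fin (p + k + 1) → ℝ | x < innerSpacing u j}).card} := by
    ext u
    have h := lt_kthInnerSpacing_iff k hk u x
    rw [show p + k + 1 - 1 - k + 1 = p + 1 by omega] at h
    exact h
  have hA : ∀ j : Fin (p + k),
      MeasurableSet {u : Fin (p + k + 1) → ℝ | x < innerSpacing u j} := fun j =>
    measurableSet_lt measurable_const
      (measurable_pi_iff.1 (measurable_innerSpacing (N := p + k + 1)) j)
  rw [hmem, measureReal_lt_card_filter _ rfl _ hA]
  refine Finset.sum_congr rfl fun t _ => ?_
  congr 1
  have hS : ∀ S ∈ (Finset.univ : Finset (Fin (p + k))).powersetCard (p + 1 + t),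
      (volume.restrict {u : Fin (p + k + 1) → ℝ | ∀ i, u i ∈ Set.Icc 0 1}).real
        {u | ∀ j ∈ S, u ∈ {u : Fin (p + k + 1) → ℝ | x < innerSpacing u j}} =
      max (1 - (p + 1 + t : ℕ) * x) 0 ^ (p + k + 1) := by
    intro S hS
    have h := volume_innerSpacing_gt S hx
    rw [(Finset.mem_powersetCard.1 hS).2] at h
    simp only [Set.mem_ofPred_eq]
    rw [Measure.real, Measure.restrict_apply (measurableSet_innerSpacing_gt S x)]
    rw [h, ENNReal.toReal_pow, ENNReal.toReal_ofReal']
  rw [Finset.sum_congr rfl hS, Finset.sum_const, Finset.card_powersetCard]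
  simp

lemma truncCdf_eq_one_sub {p k : ℕ} (hk : 1 ≤ k) (x : ℝ) :
    truncCdf (p + k + 1) k x = 1 - ∑ t ∈ Finset.range k, (-1 : ℝ) ^ t *
      ((p + t).choose p : ℝ) *
        ((p + k).choose (p + 1 + t) * max (1 - (p + 1 + t : ℕ) * x) 0 ^ (p + k + 1)) := by
  -- The case `c = p + k` expands the constant `1` with the coefficients of the tail sum, so the two
  -- sides can be matched term by term.
  have h1 := sum_neg_one_pow_choose_mul_choose p k (p + k) le_rfl
  rw [if_pos (by omega)] at h1
  conv_rhs =>
    lhs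
    rw [← h1]
  rw [← Finset.sum_sub_distrib, truncCdf, Finset.mul_sum]
  refine Finset.sum_nbij' (fun i => k - i) (fun t => k - t) ?_ ?_ ?_ ?_ ?_
  · intro i
    simp only [Finset.mem_Icc, Finset.mem_range]
    omega
  · intro i
    simp only [Finset.mem_Icc, Finset.mem_range]
    omega
  · intro i
    simp only [Finset.mem_Icc]
    omega
  · intro i
    simp only [Finset.mem_range]
    omega
  · intro i hi
    rw [Finset.mem_Icc] at hi
    obtain ⟨t, rfl⟩ : ∃ t, k = i + t := ⟨k - i, by omega⟩
    have hc := neg_one_pow_mul_choose_mul_choose_eq p (i + t) t (by omega)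
    have e1 : i + t - t = i := by omega
    have e2 : p + (i + t) + 1 - 2 = p + (i + t) - 1 := by omega
    have e3 : i + t - i = t := by omega
    have e4 : ((p + (i + t) + 1 : ℕ) : ℝ) - i = (p + 1 + t : ℕ) := by
      push_cast
      ring
    have e5 : ((p + (i + t) + 1 : ℕ) : ℝ) - 1 = (p + (i + t) : ℕ) := by
      push_cast
      ring
    rw [e1] at hc
    simp only [e2, e3, e4, e5]
    linear_combination (1 - max (1 - ((p + 1 + t : ℕ) : ℝ) * x) 0 ^ (p + (i + t) + 1)) * hc

lemma measurable_event_kthInnerSpacing_le {N : ℕ} (k : ℕ) (hk : 1 ≤ k ∧ k < N) (x : ℝ) :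
    MeasurableSet {u : Fin N → ℝ | kthInnerSpacing k hk u ≤ x} :=
  measurableSet_le (measurable_kthInnerSpacing k hk) measurable_const

/-- The distribution function of the `k`-th smallest inner spacing on the half-line. -/
lemma measureReal_kthInnerSpacing_le {Ω : Type*} [MeasurableSpace Ω] {P : Measure Ω}
    [IsProbabilityMeasure P] {N k : ℕ} (hk : 1 ≤ k ∧ k < N) {X : Fin N → Ω → ℝ}
    (hindep : iIndepFun X P)
    (hunif : ∀ j, pdf.IsUniform (X j) (Set.Icc (0 : ℝ) 1) P volume) {x : ℝ} (hx : 0 ≤ x) :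
    P.real {ω | kthInnerSpacing k hk (fun j => X j ω) ≤ x} = truncCdf N k x := by
  have hX : AEMeasurable (fun ω j => X j ω) P :=
    aemeasurable_pi_lambda _ fun j => aemeasurable_of_isUniform_Icc (hunif j)
  have hprob : IsProbabilityMeasure (P.map fun ω j => X j ω) := Measure.isProbabilityMeasure_map hX
  have h1 : P.real {ω | kthInnerSpacing k hk (fun j => X j ω) ≤ x} =
      (P.map fun ω j => X j ω).real {u | kthInnerSpacing k hk u ≤ x} := by
    rw [map_measureReal_apply_of_aemeasurable hX (measurable_event_kthInnerSpacing_le k hk x)]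
    rfl
  have h2 : {u : Fin N → ℝ | kthInnerSpacing k hk u ≤ x} =
      {u | x < kthInnerSpacing k hk u}ᶜ := by
    ext u
    simp
  rw [h1, h2, probReal_compl_eq_one_sub
    (measurableSet_lt measurable_const (measurable_kthInnerSpacing k hk)),
    map_eq_restrict_cube hindep hunif]
  obtain ⟨p, rfl⟩ : ∃ p, N = p + k + 1 := ⟨N - 1 - k, by omega⟩
  rw [measureReal_lt_kthInnerSpacing hk hx, truncCdf_eq_one_sub hk.1]

theorem mainTheorem3 {Ω : Type*} [MeasurableSpace Ω] (P : Measure Ω) [IsProbabilityMeasure P]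
    (N k : ℕ) (hk : 1 ≤ k ∧ k < N) (X : Fin N → Ω → ℝ)
    (hindep : iIndepFun X P)
    (hunif : ∀ j, pdf.IsUniform (X j) (Set.Icc (0 : ℝ) 1) P volume) :
    -- the closed form is a density of the `k`-th smallest inner spacing
    (∀ x : ℝ, 0 ≤ spacingDensity N k x) ∧
    P.map (fun ω => kthInnerSpacing k hk (fun j => X j ω)) =
      volume.withDensity (fun x => ENNReal.ofReal (spacingDensity N k x)) ∧
    -- the density as the with-boundary density averaged over the range `μ` of the points
    (3 ≤ N → ∀ x : ℝ, 0 ≤ x → spacingDensity N k x =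
      (-1) ^ k * N * ((N : ℝ) - 1) ^ 2 * ((N : ℝ) - 2) * ((N - 2).choose (k - 1) : ℝ) *
        ∑ i ∈ Finset.Icc 1 k, ∫ μ in Set.Icc (((N : ℝ) - i) * x) 1,
          (-1) ^ i * ((k - 1).choose (i - 1) : ℝ) * (1 - μ) *
            (μ - ((N : ℝ) - i) * x) ^ (N - 3)) ∧
    (∀ x : ℝ, 0 ≤ x → spacingDensity N k x =
      (-1) ^ k * N * ((N : ℝ) - 1) ^ 2 * ((N - 2).choose (k - 1) : ℝ) *
        ∑ i ∈ Finset.Icc 1 k, ∫ μ in Set.Icc (((N : ℝ) - i) * x) 1,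
          (-1) ^ i * ((k - 1).choose (i - 1) : ℝ) * (μ - ((N : ℝ) - i) * x) ^ (N - 2)) ∧
    -- the distribution function
    (∀ x : ℝ, 0 ≤ x →
      P.real {ω | kthInnerSpacing k hk (fun j => X j ω) ≤ x} = spacingCdf N k x) ∧
    (∀ x : ℝ, x < 0 → P.real {ω | kthInnerSpacing k hk (fun j => X j ω) ≤ x} = 0) := by
  have hcdf : ∀ x : ℝ, 0 ≤ x →
      P.real {ω | kthInnerSpacing k hk (fun j => X j ω) ≤ x} = truncCdf N k x :=
    fun x hx => measureReal_kthInnerSpacing_le hk hindep hunif hx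
  have hempty : ∀ x : ℝ, x < 0 → {ω | kthInnerSpacing k hk (fun j => X j ω) ≤ x} = ∅ :=
    fun x hx => Set.eq_empty_of_forall_notMem fun ω hω =>
      ((kthInnerSpacing_nonneg k hk fun j => X j ω).trans hω).not_gt hx
  -- Monotonicity comes from probability: on the half-line `truncCdf` measures increasing events.
  have hmono : MonotoneOn (truncCdf N k) (Set.Ici 0) := by
    intro x hx y hy hxy
    rw [← hcdf x hx, ← hcdf y hy]
    exact measureReal_mono fun ω (hω : _ ≤ x) => hω.trans hxy
  have hnonneg : ∀ x, 0 ≤ x → 0 ≤ truncDensity N k x :=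
    fun x hx => truncDensity_nonneg_of_monotoneOn hk hmono hx
  have hX : AEMeasurable (fun ω => kthInnerSpacing k hk (fun j => X j ω)) P :=
    (measurable_kthInnerSpacing k hk).comp_aemeasurable
      (aemeasurable_pi_lambda _ fun j => aemeasurable_of_isUniform_Icc (hunif j))
  refine ⟨fun x => ?_, ?_, fun hN x hx => spacingDensity_eq_sum_integral_one_sub hk hN hx,
    fun x hx => spacingDensity_eq_sum_integral hk hx,
    fun x hx => by rw [hcdf x hx, spacingCdf_eq_truncCdf hk hx],
    fun x hx => by rw [hempty x hx, measureReal_empty]⟩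
  · rcases lt_or_ge x 0 with hx | hx
    · exact (spacingDensity_of_neg N k hx).ge
    · rw [spacingDensity_eq_truncDensity hk hx]
      exact hnonneg x hx
  · have := Measure.isProbabilityMeasure_map hX
    have hind : (fun x => ENNReal.ofReal (spacingDensity N k x)) =
        (Set.Ici 0).indicator fun x => ENNReal.ofReal (truncDensity N k x) := by
      funext x
      by_cases hx : 0 ≤ x
      · rw [Set.indicator_of_mem (Set.mem_Ici.2 hx), spacingDensity_eq_truncDensity hk hx]
      · rw [Set.indicator_of_notMem (fun h => hx (Set.mem_Ici.1 h)), spacingDensity_of_neg N k (not_le.1 hx),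
          ENNReal.ofReal_zero]
    -- The law is a finite measure, so comparison on the half-lines `Set.Iic a` suffices.
    refine Measure.ext_of_Iic _ _ fun a => ?_
    rw [Measure.map_apply_of_aemeasurable hX measurableSet_Iic,
      withDensity_apply _ measurableSet_Iic, hind, setLIntegral_indicator measurableSet_Ici,
      Set.Ici_inter_Iic]
    change P {ω | kthInnerSpacing k hk (fun j => X j ω) ≤ a} = _
    rcases lt_or_ge a 0 with ha | ha
    · rw [hempty a ha, Set.Icc_eq_empty (not_le.2 ha)]
      simp
    · rw [← ofReal_integral_eq_lintegral_ofReal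
        (continuous_truncDensity N k).continuousOn.integrableOn_Icc
        ((ae_restrict_iff' measurableSet_Icc).2 (.of_forall fun x hx => hnonneg x hx.1)),
        integral_Icc_eq_integral_Ioc, ← intervalIntegral.integral_of_le ha,
        integral_truncDensity hk, ← hcdf a ha, ofReal_measureReal]
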